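/- Let \(L=\{(i,j,k)\in\mathbb{Z}^3 : i+j+k\equiv 0 \bmod 2\}\), and let \(\mathcal{H}\subseteq L\) satisfy: (1) if \((i,j,k)\in\mathcal{H}\), then \((i',j',k')\in\mathcal{H}\) for every \((i',j',k')\in L\) with \(|i'-i|+|j'-j|\le k'-k\); (2) for every \((i',j',k')\in\mathcal{H}\), the set \(\{(i,j,k)\in\mathcal{H} : |i'-i|+|j'-j|\le k'-k\}\) is finite. Let \(H_{\mathrm{init}}=\{(a,b,c)\in\mathcal{H} : (a,b,c-2)\notin\mathcal{H}\}\), let \(\alpha,\beta\) and \(x_{a,b,c}\), for \((a,b,c)\in H_{\mathrm{init}}\), be independent indeterminates, and let \(K\) be the field of rational functions in the \(x_{a,b,c}\) over \(\mathbb{Z}[\alpha,\beta]\) (the fraction field of \(\mathbb{Z}[\alpha,\beta][x_{a,b,c} : (a,b,c)\in H_{\mathrm{init}}]\)). Consider arrays \((y_{i,j,k})_{(i,j,k)\in\mathcal{H}}\) of elements of \(K\) with initial entries \(y_{a,b,c}=x_{a,b,c}\) for \((a,b,c)\in H_{\mathrm{init}}\) that satisfy the octahedron recurrence \[ y_{i,j,k}\,y_{i,j,k-2}=\alpha\,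 y_{i+1,j,k-1}\,y_{i-1,j,k-1}+\beta\, y_{i,j+1,k-1}\,y_{i,j-1,k-1} \] whenever \((i,j,k)\) and \((i,j,k-2)\) both lie in \(\mathcal{H}\). Then such an array exists, and in every such array each entry \(y_{i,j,k}\), \((i,j,k)\in\mathcal{H}\), is nonzero and is a Laurent polynomial in the initial entries \(y_{a,b,c}\), \((a,b,c)\in H_{\mathrm{init}}\), with coefficients in \(\mathbb{Z}[\alpha,\beta]\). -/

import Mathlib

noncomputable section

namespace Octahedron

/-- The lattice `L` of all `(i, j, k)` in `ℤ³` with `i + j + k` even. -/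
def evenLattice : Set (ℤ × ℤ × ℤ) :=
  {h | Even (h.1 + h.2.1 + h.2.2)}

/-- `InCone (i, j, k) (i', j', k')` says `|i' - i| + |j' - j| ≤ k' - k`: the second point lies in
the upward light cone of the first one. -/
def InCone (h h' : ℤ × ℤ × ℤ) : Prop :=
  |h'.1 - h.1| + |h'.2.1 - h.2.1| ≤ h'.2.2 - h.2.2

/-- The conditions on the indexing set `H` of the array. -/
structure IsIndexSet (H : Set (ℤ × ℤ × ℤ)) : Prop where
  subset_lattice : H ⊆ evenLattice
  cone_closed : ∀ h ∈ H, ∀ h' ∈ evenLattice, InCone h h' → h' ∈ H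
  finite_below : ∀ h' ∈ H, {h | h ∈ H ∧ InCone h h'}.Finite

/-- The set `H_init` of all `(a, b, c)` in `H` such that `(a, b, c - 2)` is not in `H`. -/
def initSet (H : Set (ℤ × ℤ × ℤ)) : Set (ℤ × ℤ × ℤ) :=
  {h | h ∈ H ∧ (h.1, h.2.1, h.2.2 - 2) ∉ H}

/-- The polynomial ring `ℤ[α, β]` in two indeterminates. -/
abbrev Coeff : Type := MvPolynomial (Fin 2) ℤ

/-- The field of rational functions over `ℤ[α, β]` in independent variables indexed by `H_init`. -/
abbrev RatField (H : Set (ℤ × ℤ × ℤ)) : Type :=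
  FractionRing (MvPolynomial (initSet H) Coeff)

/-- The indeterminate `α` as a rational function. -/
def alpha (H : Set (ℤ × ℤ × ℤ)) : RatField H :=
  algebraMap Coeff (RatField H) (MvPolynomial.X 0)

/-- The indeterminate `β` as a rational function. -/
def beta (H : Set (ℤ × ℤ × ℤ)) : RatField H :=
  algebraMap Coeff (RatField H) (MvPolynomial.X 1)

/-- The independent variable attached to the index `a` of an initial entry. -/
def initVar (H : Set (ℤ × ℤ × ℤ)) (a : initSet H) : RatField H :=
  algebraMap (MvPolynomial (initSet H) Coeff) (RatField H) (MvPolynomial.X a)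

/-- The Laurent polynomials with coefficients in `ℤ[α, β]` in the variables indexed by `H_init`,
as a subalgebra of the field of rational functions. -/
def laurentRing (H : Set (ℤ × ℤ × ℤ)) : Subalgebra Coeff (RatField H) :=
  Algebra.adjoin Coeff (Set.range (initVar H) ∪ Set.range (fun a => (initVar H a)⁻¹))

/-- `y`, restricted to `H`, is an array whose initial entries are the independent variables and
which satisfies the octahedron recurrence. If `(i, j, k)` and `(i, j, k - 2)` lie in an index set
`H`, then so do the other four indices in the recurrence. The values of `y` outside `H` play
no role. -/
structure IsOctahedronArray (H : Set (ℤ × ℤ × ℤ)) (y : ℤ × ℤ × ℤ → RatField H) : Prop where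
  init : ∀ a : initSet H, y a = initVar H a
  recurrence : ∀ i j k : ℤ, (i, j, k) ∈ H → (i, j, k - 2) ∈ H →
    y (i, j, k) * y (i, j, k - 2) =
      alpha H * y (i + 1, j, k - 1) * y (i - 1, j, k - 1) +
      beta H * y (i, j + 1, k - 1) * y (i, j - 1, k - 1)

end Octahedron

end

/-
Restricting to the light cone below an entry, we may induct on finite convex index sets. Removing
a bottom point `a` replaces the initial entry `x` at `a` by `P / x`, where `P` is the numerator of
the recurrence above `a`. By the induction hypothesis every entry is a Laurent polynomial in the new
initial entries, so `P`, which is prime, is the only possible denominator besides monomials. It is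
excluded by setting `α = β = 1`, one of the four variables of `P` to `-1` and all other variables
to `1`: this kills `P`, and it remains to see that the entry stays finite.

If there is another bottom point `a'`, remove `a'` instead of `a`; the sign can be placed at a
variable of `P` that does not occur in the recurrence above `a'`, so all new initial entries stay
finite and nonzero. If `a` lies below everything, remove the light cone below `a + (0, 0, 2)`. The
entry there becomes `0`, and the new initial entries stay finite and nonzero because of a
cancellation in the entry at `a + (0, 0, 4)` (singularity confinement).
-/

namespace Octahedron

section Specialization

variable {R K F : Type*} [CommRing R] [Field K] [Algebra R K] [Field F]

/-- The fraction `u` over `R` is regular at the kernel of `φ` and takes the value `v` there. The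
two equations say `u = p / q` and `v = φ p / φ q`. -/
def SpecializesTo (φ : R →+* F) (u : K) (v : F) : Prop :=
  ∃ p q : R, φ q ≠ 0 ∧ u * algebraMap R K q = algebraMap R K p ∧ v * φ q = φ p

namespace SpecializesTo

variable {φ : R →+* F} {u u' : K} {v v' : F}

theorem of_algebraMap (φ : R →+* F) (r : R) : SpecializesTo φ (algebraMap R K r) (φ r) :=
  ⟨r, 1, by simp, by simp, by simp⟩

theorem add (h : SpecializesTo φ u v) (h' : SpecializesTo φ u' v') :
    SpecializesTo φ (u + u') (v + v') := by
  obtain ⟨p, q, hq, hu, hv⟩ := h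
  obtain ⟨p', q', hq', hu', hv'⟩ := h'
  refine ⟨p * q' + p' * q, q * q', by simp [hq, hq'], ?_, ?_⟩
  · simp only [map_mul, map_add, ← hu, ← hu']
    ring
  · simp only [map_mul, map_add, ← hv, ← hv']
    ring

theorem mul (h : SpecializesTo φ u v) (h' : SpecializesTo φ u' v') :
    SpecializesTo φ (u * u') (v * v') := by
  obtain ⟨p, q, hq, hu, hv⟩ := h
  obtain ⟨p', q', hq', hu', hv'⟩ := h'
  refine ⟨p * p', q * q', by simp [hq, hq'], ?_, ?_⟩
  · simp only [map_mul, ← hu, ← hu']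
    ring
  · simp only [map_mul, ← hv, ← hv']
    ring

variable [FaithfulSMul R K]

theorem eq_of_mul_eq (h : SpecializesTo φ u v) {r s : R}
    (hu : u * algebraMap R K s = algebraMap R K r) : v * φ s = φ r := by
  obtain ⟨p, q, hq, hu', hv⟩ := h
  have hcross : r * q = p * s := by
    apply FaithfulSMul.algebraMap_injective R K
    simp only [map_mul, ← hu, ← hu']
    ring
  have hφ : φ r * φ q = φ p * φ s := by rw [← map_mul, hcross, map_mul]
  apply mul_right_cancel₀ hq
  rw [hφ, ← hv]
  ring

theorem ne_zero (h : SpecializesTo φ u v) (hv : v ≠ 0) : u ≠ 0 := by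
  rintro rfl
  exact hv (by simpa using h.eq_of_mul_eq (r := 0) (s := 1) (by simp))

theorem inv (h : SpecializesTo φ u v) (hv : v ≠ 0) : SpecializesTo φ u⁻¹ v⁻¹ := by
  have hu := h.ne_zero hv
  obtain ⟨p, q, hq, hpq, hφ⟩ := h
  refine ⟨q, p, ?_, ?_, ?_⟩
  · exact hφ ▸ mul_ne_zero hv hq
  · rw [← hpq, inv_mul_cancel_left₀ hu]
  · rw [← hφ, inv_mul_cancel_left₀ hv]

theorem div (h : SpecializesTo φ u v) (h' : SpecializesTo φ u' v') (hv' : v' ≠ 0) :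
    SpecializesTo φ (u / u') (v / v') := by
  simpa only [div_eq_mul_inv] using h.mul (h'.inv hv')

theorem of_mul (h : SpecializesTo φ (u * u') v) (h' : SpecializesTo φ u' v') (hv' : v' ≠ 0) :
    SpecializesTo φ u (v / v') := by
  simpa only [mul_div_cancel_right₀ u (h'.ne_zero hv')] using h.div h' hv'

end SpecializesTo

/-- The local ring of `R` at the kernel of `φ`, as a subring of `K`: all fractions that have a
value under `φ`. -/
def regularSubring (K : Type*) [Field K] [Algebra R K] (φ : R →+* F) : Subring K where
  carrier := {u | ∃ v, SpecializesTo φ u v}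
  one_mem' := ⟨φ 1, by simpa using SpecializesTo.of_algebraMap (K := K) φ 1⟩
  zero_mem' := ⟨φ 0, by simpa using SpecializesTo.of_algebraMap (K := K) φ 0⟩
  add_mem' := fun ⟨_, h⟩ ⟨_, h'⟩ => ⟨_, h.add h'⟩
  mul_mem' := fun ⟨_, h⟩ ⟨_, h'⟩ => ⟨_, h.mul h'⟩
  neg_mem' := fun ⟨_, h⟩ =>
    ⟨_, by simpa using (SpecializesTo.of_algebraMap (K := K) φ (-1)).mul h⟩

/-- `u` is a unit of the local ring of `R` at the kernel of `φ`. -/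
def IsUnitAt (φ : R →+* F) (u : K) : Prop :=
  ∃ v, v ≠ 0 ∧ SpecializesTo φ u v

theorem IsUnitAt.mem_regularSubring {φ : R →+* F} {u : K} (h : IsUnitAt φ u) :
    u ∈ regularSubring K φ :=
  h.imp fun _ h => h.2

theorem IsUnitAt.inv [FaithfulSMul R K] {φ : R →+* F} {u : K} (h : IsUnitAt φ u) :
    IsUnitAt φ u⁻¹ := by
  obtain ⟨v, hv, h⟩ := h
  exact ⟨v⁻¹, inv_ne_zero hv, h.inv hv⟩

theorem inv_algebraMap_mem_ofField [IsFractionRing R K] {T : Submonoid R}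
    {hT : T ≤ nonZeroDivisors R} {s : R} (hs : s ∈ T) :
    (algebraMap R K s)⁻¹ ∈ Localization.subalgebra.ofField K T hT :=
  ⟨1, s, hs, by simp⟩

/-- The values of `φ` detect poles: a fraction with a pole along `P` is not regular at a zero of
`P`. -/
theorem mem_ofField_of_mem_sup_powers [IsDomain R] [IsFractionRing R K] {M : Submonoid R} {P : R}
    {hM : M ≤ nonZeroDivisors R} {hMP : M ⊔ Submonoid.powers P ≤ nonZeroDivisors R}
    (hP : Prime P) {φ : R →+* F} (hφ : φ P = 0) {u : K}
    (hpole : u ∈ Localization.subalgebra.ofField K (M ⊔ Submonoid.powers P) hMP)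
    (hreg : u ∈ regularSubring K φ) : u ∈ Localization.subalgebra.ofField K M hM := by
  have hinj := FaithfulSMul.algebraMap_injective R K
  obtain ⟨v, p, q, hq, hpq, -⟩ := hreg
  obtain ⟨r, s, hs, hu⟩ := hpole
  obtain ⟨m, hm, _, ⟨n, rfl⟩, rfl⟩ := Submonoid.mem_sup.1 hs
  have hqP : ¬ P ∣ q := fun h => hq (by simpa [hφ] using map_dvd φ h)
  have hne : ∀ s ∈ M ⊔ Submonoid.powers P, algebraMap R K s ≠ 0 := fun s hs =>
    (map_ne_zero_iff _ hinj).2 (nonZeroDivisors.ne_zero (hMP hs))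
  have hPn : algebraMap R K (P ^ n) ≠ 0 := hne _ (Submonoid.mem_sup_right ⟨n, rfl⟩)
  have hm0 : algebraMap R K m ≠ 0 := hne _ (Submonoid.mem_sup_left hm)
  have hur : u * algebraMap R K (m * P ^ n) = algebraMap R K r :=
    (eq_mul_inv_iff_mul_eq₀ (hne _ hs)).1 hu
  have hcross : r * q = P ^ n * (p * m) := by
    apply hinj
    simp only [map_mul, ← hur, ← hpq]
    ring
  obtain ⟨r', rfl⟩ := hP.pow_dvd_of_dvd_mul_right n hqP ⟨_, hcross⟩
  refine ⟨r', m, hm, (eq_mul_inv_iff_mul_eq₀ hm0).2 (mul_right_cancel₀ hPn ?_)⟩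
  rw [mul_assoc, ← map_mul, hur, ← map_mul, mul_comm]

end Specialization

section Exchange

open MvPolynomial

variable {σ F : Type*} [CommRing F]

/-- The value of a polynomial over `ℤ[α, β]` at given values of `α`, `β` and the variables. -/
noncomputable def evalAt (α β : F) (x : σ → F) : MvPolynomial σ Coeff →+* F :=
  eval₂Hom (eval₂Hom (Int.castRingHom F) ![α, β]) x

@[simp] theorem evalAt_X (α β : F) (x : σ → F) (a : σ) : evalAt α β x (X a) = x a := by
  simp [evalAt]

@[simp] theorem evalAt_alpha (α β : F) (x : σ → F) : evalAt α β x (C (X 0)) = α := by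
  simp [evalAt]

@[simp] theorem evalAt_beta (α β : F) (x : σ → F) : evalAt α β x (C (X 1)) = β := by
  simp [evalAt]

theorem evalAt_mem {S : Subring F} {α β : F} {x : σ → F} (hα : α ∈ S) (hβ : β ∈ S)
    (hx : ∀ a, x a ∈ S) (p : MvPolynomial σ Coeff) : evalAt α β x p ∈ S :=
  eval₂_mem (fun _ _ => eval₂_mem (fun _ _ => intCast_mem S _) (by simp [Fin.forall_fin_two, *]))
    hx

/-- The numerator `α x_e x_w + β x_n x_s` of the recurrence whose four middle entries are the
variables indexed by `e`, `w`, `n`, `s`. -/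
noncomputable def exchangePoly (e w n s : σ) : MvPolynomial σ Coeff :=
  C (X 0) * X e * X w + C (X 1) * X n * X s

theorem evalAt_exchangePoly (α β : F) (x : σ → F) (e w n s : σ) :
    evalAt α β x (exchangePoly e w n s) = α * x e * x w + β * x n * x s := by
  simp [exchangePoly]

theorem isRelPrime_exchange_coeffs {w n s : σ} (hwn : w ≠ n) (hws : w ≠ s) :
    IsRelPrime (C (X 0) * X w : MvPolynomial σ Coeff) (C (X 1) * X n * X s) := by
  classical
  have hα : Irreducible (C (X 0) : MvPolynomial σ Coeff) :=
    ((prime_C_iff σ).2 X_prime).irreducible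
  have hw : Irreducible (X w : MvPolynomial σ Coeff) := X_prime.irreducible
  refine IsRelPrime.mul_left (hα.isRelPrime_iff_not_dvd.2 fun h => ?_)
    (hw.isRelPrime_iff_not_dvd.2 fun h => ?_)
  · simpa using map_dvd (evalAt (0 : ℤ) 1 fun _ => 1) h
  · simpa [hwn.symm, hws.symm] using map_dvd (evalAt (1 : ℤ) 1 fun a => if a = w then 0 else 1) h

theorem prime_exchangePoly {e w n s : σ} (hew : e ≠ w) (hen : e ≠ n) (hes : e ≠ s)
    (hwn : w ≠ n) (hws : w ≠ s) : Prime (exchangePoly e w n s) := by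
  classical
  have hαw : e ∉ (C (X 0) * X w : MvPolynomial σ Coeff).vars := fun h => by
    simpa [vars_C, vars_X, hew] using vars_mul _ _ h
  have hβns : e ∉ (C (X 1) * X n * X s : MvPolynomial σ Coeff).vars := fun h => by
    have := (vars_mul _ _).trans (Finset.union_subset_union_left (vars_mul _ _)) h
    simp [vars_C, vars_X, hen, hes] at this
  have hne : (C (X 0) * X w : MvPolynomial σ Coeff) ≠ 0 :=
    mul_ne_zero ((prime_C_iff σ).2 X_prime).ne_zero (X_ne_zero w)
  rw [exchangePoly, mul_right_comm, ← irreducible_iff_prime]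
  exact irreducible_mul_X_add _ _ e hne hαw hβns (isRelPrime_exchange_coeffs hwn hws)

end Exchange

section IndexSets

variable {D : Set (ℤ × ℤ × ℤ)}

theorem InCone.refl (g : ℤ × ℤ × ℤ) : InCone g g := by simp [InCone]

theorem InCone.trans {g g' g'' : ℤ × ℤ × ℤ} (h : InCone g g') (h' : InCone g' g'') :
    InCone g g'' := by
  simp only [InCone] at *
  grind

theorem InCone.antisymm {g g' : ℤ × ℤ × ℤ} (h : InCone g g') (h' : InCone g' g) : g = g' := by
  simp only [InCone, Prod.ext_iff] at *
  grind

theorem inCone_iff {i j k i' j' k' : ℤ} : InCone (i, j, k) (i', j', k') ↔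
    i' - i + (j' - j) ≤ k' - k ∧ i' - i - (j' - j) ≤ k' - k ∧
      i - i' + (j' - j) ≤ k' - k ∧ i - i' - (j' - j) ≤ k' - k := by
  simp only [InCone]
  grind

theorem mem_evenLattice {i j k : ℤ} : (i, j, k) ∈ evenLattice ↔ (i + j + k) % 2 = 0 :=
  Int.even_iff

/-- The light cone below `p`. -/
def lowerCone (p : ℤ × ℤ × ℤ) : Set (ℤ × ℤ × ℤ) := {g | InCone g p}

/-- The four middle indices of the recurrence that computes the entry at `(i, j, k + 2)` from the
entry at `(i, j, k)`. -/
def neighbors (g : ℤ × ℤ × ℤ) : Set (ℤ × ℤ × ℤ) :=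
  {(g.1 + 1, g.2.1, g.2.2 + 1), (g.1 - 1, g.2.1, g.2.2 + 1),
    (g.1, g.2.1 + 1, g.2.2 + 1), (g.1, g.2.1 - 1, g.2.2 + 1)}

theorem mem_neighbors_iff {i j k : ℤ} {v : ℤ × ℤ × ℤ} : v ∈ neighbors (i, j, k) ↔
    v = (i + 1, j, k + 1) ∨ v = (i - 1, j, k + 1) ∨ v = (i, j + 1, k + 1) ∨ v = (i, j - 1, k + 1) :=
  Iff.rfl

theorem exists_mem_neighbors_notMem {a a' : ℤ × ℤ × ℤ} (h : a ≠ a') :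
    ∃ v ∈ neighbors a, v ∉ neighbors a' := by
  by_contra! hsub
  obtain ⟨a, b, c⟩ := a
  obtain ⟨a', b', c'⟩ := a'
  have hE := hsub (a + 1, b, c + 1) (by simp [mem_neighbors_iff])
  have hW := hsub (a - 1, b, c + 1) (by simp [mem_neighbors_iff])
  have hN := hsub (a, b + 1, c + 1) (by simp [mem_neighbors_iff])
  have hS := hsub (a, b - 1, c + 1) (by simp [mem_neighbors_iff])
  simp only [mem_neighbors_iff, Prod.mk.injEq, ne_eq] at *
  omega

theorem eq_or_mem_neighbors_or_eq {a b c : ℤ} {g : ℤ × ℤ × ℤ} (ha : (a, b, c) ∈ evenLattice)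
    (hg : g ∈ evenLattice) (h : InCone (a, b, c) g) (h' : InCone g (a, b, c + 2)) :
    g = (a, b, c) ∨ g ∈ neighbors (a, b, c) ∨ g = (a, b, c + 2) := by
  obtain ⟨i, j, k⟩ := g
  simp only [mem_evenLattice, inCone_iff, mem_neighbors_iff, Prod.mk.injEq] at *
  omega

/-- A set of lattice points that contains with any two points everything between them in the light
cone order, and only finitely many points below each of its points. Besides the index sets this
covers what remains of them after removing a light cone or restricting to one. -/
structure IsConvexIndexSet (D : Set (ℤ × ℤ × ℤ)) : Prop where
  subset_lattice : D ⊆ evenLattice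
  between_mem : ∀ g ∈ D, ∀ g'' ∈ D, ∀ g' ∈ evenLattice, InCone g g' → InCone g' g'' → g' ∈ D
  finite_below : ∀ g ∈ D, (D ∩ lowerCone g).Finite

theorem IsIndexSet.isConvexIndexSet {H : Set (ℤ × ℤ × ℤ)} (hH : IsIndexSet H) :
    IsConvexIndexSet H where
  subset_lattice := hH.subset_lattice
  between_mem g hg _ _ g' hg' h _ := hH.cone_closed g hg g' hg' h
  finite_below := hH.finite_below

namespace IsConvexIndexSet

theorem inter_lowerCone (hD : IsConvexIndexSet D) (p : ℤ × ℤ × ℤ) :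
    IsConvexIndexSet (D ∩ lowerCone p) where
  subset_lattice := Set.inter_subset_left.trans hD.subset_lattice
  between_mem g hg g'' hg'' g' hg' h h' :=
    ⟨hD.between_mem g hg.1 g'' hg''.1 g' hg' h h', h'.trans hg''.2⟩
  finite_below g hg := (hD.finite_below g hg.1).subset
    (Set.inter_subset_inter_left _ Set.inter_subset_left)

theorem sdiff_lowerCone (hD : IsConvexIndexSet D) (p : ℤ × ℤ × ℤ) :
    IsConvexIndexSet (D \ lowerCone p) where
  subset_lattice := Set.sdiff_subset.trans hD.subset_lattice
  between_mem g hg g'' hg'' g' hg' h h' :=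
    ⟨hD.between_mem g hg.1 g'' hg''.1 g' hg' h h', fun hp => hg.2 (h.trans hp)⟩
  finite_below g hg := (hD.finite_below g hg.1).subset
    (Set.inter_subset_inter_left _ Set.sdiff_subset)

theorem neighbors_subset (hD : IsConvexIndexSet D) {i j k : ℤ} (h : (i, j, k) ∈ D)
    (h2 : (i, j, k + 2) ∈ D) : neighbors (i, j, k) ⊆ D := by
  have he := mem_evenLattice.1 (hD.subset_lattice h)
  intro v hv
  obtain rfl | rfl | rfl | rfl := mem_neighbors_iff.1 hv <;>
    refine hD.between_mem _ h _ h2 _ (mem_evenLattice.2 ?_) (inCone_iff.2 ?_) (inCone_iff.2 ?_) <;>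
    omega

theorem ncard_lt (hD : IsConvexIndexSet D) {g g' : ℤ × ℤ × ℤ} (hg : g ∈ D) (h : InCone g' g)
    (hne : g' ≠ g) : (D ∩ lowerCone g').ncard < (D ∩ lowerCone g).ncard := by
  apply Set.ncard_lt_ncard _ (hD.finite_below g hg)
  refine ⟨fun p hp => ⟨hp.1, hp.2.trans h⟩, fun hs => hne ?_⟩
  exact h.antisymm (hs ⟨hg, InCone.refl g⟩).2

theorem induction (hD : IsConvexIndexSet D) {p : ℤ × ℤ × ℤ → Prop} (init : ∀ g ∈ initSet D, p g)
    (step : ∀ i j k : ℤ, (i, j, k) ∈ D → (i, j, k + 2) ∈ D → p (i, j, k) →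
      (∀ v ∈ neighbors (i, j, k), p v) → p (i, j, k + 2)) : ∀ g ∈ D, p g := by
  intro g
  induction hn : (D ∩ lowerCone g).ncard using Nat.strong_induction_on generalizing g with
  | _ n ih =>
    intro hg
    subst hn
    have below : ∀ g' ∈ D, InCone g' g → g' ≠ g → p g' := fun g' hg' hc hne =>
      ih _ (hD.ncard_lt hg hc hne) g' rfl hg'
    obtain ⟨i, j, k⟩ := g
    by_cases h2 : (i, j, k - 2) ∈ D
    · obtain ⟨k, rfl⟩ : ∃ k', k = k' + 2 := ⟨k - 2, by ring⟩
      rw [add_sub_cancel_right] at h2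
      refine step i j k h2 hg (below _ h2 (by simp [InCone]) (by simp)) fun v hv =>
        below v (hD.neighbors_subset h2 hg hv) ?_ ?_ <;>
      rcases hv with rfl | rfl | rfl | rfl <;> grind [inCone_iff]
    · exact init (i, j, k) ⟨hg, h2⟩

end IsConvexIndexSet

/-- No other point of `D` lies below `a`. -/
def IsBottom (D : Set (ℤ × ℤ × ℤ)) (a : ℤ × ℤ × ℤ) : Prop :=
  a ∈ D ∧ ∀ g ∈ D, InCone g a → g = a

theorem IsConvexIndexSet.exists_isBottom_inCone (hD : IsConvexIndexSet D) {g : ℤ × ℤ × ℤ}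
    (hg : g ∈ D) : ∃ a, IsBottom D a ∧ InCone a g := by
  obtain ⟨a, ⟨haD, hag⟩, hmin⟩ := Set.exists_min_image _ (fun p => p.2.2) (hD.finite_below g hg)
    ⟨g, hg, InCone.refl g⟩
  refine ⟨a, ⟨haD, fun p hp hpa => hpa.antisymm ?_⟩, hag⟩
  have hheight := hmin p ⟨hp, hpa.trans hag⟩
  simp only [InCone] at hpa ⊢
  grind

theorem IsBottom.mem_initSet {a : ℤ × ℤ × ℤ} (ha : IsBottom D a) : a ∈ initSet D := by
  refine ⟨ha.1, fun h => ?_⟩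
  simpa [Prod.ext_iff] using ha.2 _ h (by simp [InCone])

theorem IsBottom.neighbors_subset_initSet (hD : IsConvexIndexSet D) {a b c : ℤ}
    (ha : IsBottom D (a, b, c)) (hY : (a, b, c + 2) ∈ D) :
    neighbors (a, b, c) ⊆ initSet D := by
  refine fun v hv => ⟨hD.neighbors_subset ha.1 hY hv, fun h => ?_⟩
  have hlow := ha.2 _ h
  rcases hv with rfl | rfl | rfl | rfl <;> grind [inCone_iff]

theorem initSet_inter_lowerCone_subset (p : ℤ × ℤ × ℤ) :
    initSet (D ∩ lowerCone p) ⊆ initSet D :=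
  fun _ hg => ⟨hg.1.1, fun h => hg.2 ⟨h, InCone.trans (by simp [InCone]) hg.1.2⟩⟩

theorem mem_initSet_sdiff_lowerCone {p g : ℤ × ℤ × ℤ} (hg : g ∈ initSet (D \ lowerCone p)) :
    g ∈ initSet D ∨ ∃ i j k : ℤ, g = (i, j, k + 2) ∧ (i, j, k + 2) ∈ D ∧
      ¬ InCone (i, j, k + 2) p ∧ (i, j, k) ∈ D ∧ InCone (i, j, k) p := by
  obtain ⟨i, j, k⟩ := g
  obtain ⟨⟨hgD, hgp⟩, hbelow⟩ := hg
  by_cases h : (i, j, k - 2) ∈ D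
  · refine Or.inr ⟨i, j, k - 2, ?_⟩
    rw [sub_add_cancel]
    exact ⟨rfl, hgD, hgp, h, not_not.1 fun hp => hbelow ⟨h, hp⟩⟩
  · exact Or.inl ⟨hgD, h⟩

theorem IsBottom.mem_initSet_sdiff_lowerCone {a b c : ℤ} (ha : IsBottom D (a, b, c))
    {g : ℤ × ℤ × ℤ} (hg : g ∈ initSet (D \ lowerCone (a, b, c))) :
    g ∈ initSet D ∨ g = (a, b, c + 2) ∧ (a, b, c + 2) ∈ D := by
  obtain hg | ⟨i, j, k, rfl, hgD, -, hk, hka⟩ := Octahedron.mem_initSet_sdiff_lowerCone hg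
  · exact Or.inl hg
  · obtain ⟨rfl, rfl, rfl⟩ : i = a ∧ j = b ∧ k = c := by simpa using ha.2 _ hk hka
    exact Or.inr ⟨rfl, hgD⟩

end IndexSets

section Arrays

variable {D : Set (ℤ × ℤ × ℤ)} {K : Type*} [Field K] {α β : K} {y : ℤ × ℤ × ℤ → K}

/-- The right-hand side of the recurrence at `(i, j, k + 2)`, as a function of the index
`(i, j, k)` two steps below. -/
def exchangeSum (α β : K) (y : ℤ × ℤ × ℤ → K) : ℤ × ℤ × ℤ → K
  | (i, j, k) => α * y (i + 1, j, k + 1) * y (i - 1, j, k + 1) +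
      β * y (i, j + 1, k + 1) * y (i, j - 1, k + 1)

/-- `y` is nonzero on `D` and satisfies the octahedron recurrence with coefficients `α`, `β`. -/
structure IsSolution (D : Set (ℤ × ℤ × ℤ)) (α β : K) (y : ℤ × ℤ × ℤ → K) : Prop where
  ne_zero : ∀ g ∈ D, y g ≠ 0
  recurrence : ∀ i j k : ℤ, (i, j, k) ∈ D → (i, j, k + 2) ∈ D →
    y (i, j, k + 2) * y (i, j, k) = exchangeSum α β y (i, j, k)

theorem IsSolution.mono {D' : Set (ℤ × ℤ × ℤ)} (h : IsSolution D α β y) (hs : D' ⊆ D) :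
    IsSolution D' α β y :=
  ⟨fun g hg => h.ne_zero g (hs hg), fun i j k h1 h2 => h.recurrence i j k (hs h1) (hs h2)⟩

open Classical in
/-- The array computed from the initial entries `x` by the recurrence, with division by zero giving
zero. -/
noncomputable def recurrenceArray (hD : IsConvexIndexSet D) (α β : K) (x : initSet D → K) :
    ℤ × ℤ × ℤ → K
  | (i, j, k) =>
    if _h : (i, j, k) ∈ D ∧ (i, j, k - 2) ∈ D then
      (α * recurrenceArray hD α β x (i + 1, j, k - 1) *
          recurrenceArray hD α β x (i - 1, j, k - 1) +
        β * recurrenceArray hD α β x (i, j + 1, k - 1) *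
          recurrenceArray hD α β x (i, j - 1, k - 1)) /
        recurrenceArray hD α β x (i, j, k - 2)
    else Function.extend Subtype.val x 0 (i, j, k)
termination_by g => (D ∩ lowerCone g).ncard
decreasing_by
  all_goals exact hD.ncard_lt ‹_ ∧ _›.1 (by simp [InCone]) (by simp)

theorem recurrenceArray_init (hD : IsConvexIndexSet D) (α β : K) (x : initSet D → K)
    (a : initSet D) : recurrenceArray hD α β x a = x a := by
  obtain ⟨⟨i, j, k⟩, h⟩ := a
  rw [recurrenceArray, dif_neg fun h' => h.2 h'.2]
  exact Subtype.val_injective.extend_apply x 0 ⟨(i, j, k), h⟩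

theorem recurrenceArray_step (hD : IsConvexIndexSet D) (α β : K) (x : initSet D → K) {i j k : ℤ}
    (h : (i, j, k) ∈ D) (h2 : (i, j, k + 2) ∈ D) : recurrenceArray hD α β x (i, j, k + 2) =
      exchangeSum α β (recurrenceArray hD α β x) (i, j, k) /
        recurrenceArray hD α β x (i, j, k) := by
  have hk : k + 2 - 1 = k + 1 := by ring
  rw [recurrenceArray, dif_pos ⟨h2, by rwa [add_sub_cancel_right]⟩, hk, add_sub_cancel_right]
  rfl

theorem isSolution_recurrenceArray_of_pos [LinearOrder K] [IsStrictOrderedRing K]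
    (hD : IsConvexIndexSet D) (hα : 0 < α) (hβ : 0 < β) {x : initSet D → K} (hx : ∀ a, 0 < x a) :
    IsSolution D α β (recurrenceArray hD α β x) := by
  have pos : ∀ g ∈ D, 0 < recurrenceArray hD α β x g := by
    refine hD.induction (fun g hg => ?_) fun i j k h h2 hpos hnbr => ?_
    · rw [recurrenceArray_init hD α β x ⟨g, hg⟩]
      exact hx _
    · have hE := hnbr (i + 1, j, k + 1) (by simp [mem_neighbors_iff])
      have hW := hnbr (i - 1, j, k + 1) (by simp [mem_neighbors_iff])
      have hN := hnbr (i, j + 1, k + 1) (by simp [mem_neighbors_iff])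
      have hS := hnbr (i, j - 1, k + 1) (by simp [mem_neighbors_iff])
      rw [recurrenceArray_step hD α β x h h2, exchangeSum]
      positivity
  refine ⟨fun g hg => (pos g hg).ne', fun i j k h h2 => ?_⟩
  rw [recurrenceArray_step hD α β x h h2, div_mul_cancel₀ _ (pos _ h).ne']

/-- The ring of Laurent polynomials in the initial entries, with coefficients in `ℤ[α, β]`. -/
def laurentSubring (D : Set (ℤ × ℤ × ℤ)) (α β : K) (y : ℤ × ℤ × ℤ → K) : Subring K :=
  Subring.closure ({α, β} ∪ (y '' initSet D ∪ (fun g => (y g)⁻¹) '' initSet D))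

theorem laurentSubring_le {S : Subring K} (hα : α ∈ S) (hβ : β ∈ S)
    (h : ∀ g ∈ initSet D, y g ∈ S ∧ (y g)⁻¹ ∈ S) : laurentSubring D α β y ≤ S := by
  rw [laurentSubring, Subring.closure_le]
  rintro u ((rfl | rfl) | ⟨g, hg, rfl⟩ | ⟨g, hg, rfl⟩)
  exacts [hα, hβ, (h g hg).1, (h g hg).2]

theorem alpha_mem_laurentSubring : α ∈ laurentSubring D α β y :=
  Subring.subset_closure (by simp)

theorem beta_mem_laurentSubring : β ∈ laurentSubring D α β y :=
  Subring.subset_closure (by simp)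

theorem mem_laurentSubring_of_mem_initSet {g : ℤ × ℤ × ℤ} (hg : g ∈ initSet D) :
    y g ∈ laurentSubring D α β y :=
  Subring.subset_closure (Or.inr (Or.inl ⟨g, hg, rfl⟩))

theorem inv_mem_laurentSubring_of_mem_initSet {g : ℤ × ℤ × ℤ} (hg : g ∈ initSet D) :
    (y g)⁻¹ ∈ laurentSubring D α β y :=
  Subring.subset_closure (Or.inr (Or.inr ⟨g, hg, rfl⟩))

theorem laurentSubring_mono {D' : Set (ℤ × ℤ × ℤ)} (h : initSet D' ⊆ initSet D) :
    laurentSubring D' α β y ≤ laurentSubring D α β y :=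
  laurentSubring_le alpha_mem_laurentSubring beta_mem_laurentSubring fun _ hg =>
    ⟨mem_laurentSubring_of_mem_initSet (h hg), inv_mem_laurentSubring_of_mem_initSet (h hg)⟩

end Arrays

section Generic

open MvPolynomial

variable {D : Set (ℤ × ℤ × ℤ)} {F : Type*} [Field F]

theorem algebraMap_alpha (D : Set (ℤ × ℤ × ℤ)) :
    algebraMap (MvPolynomial (initSet D) Coeff) (RatField D) (C (X 0)) = alpha D := by
  rw [alpha, IsScalarTower.algebraMap_apply Coeff (MvPolynomial (initSet D) Coeff) (RatField D)]
  rfl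

theorem algebraMap_beta (D : Set (ℤ × ℤ × ℤ)) :
    algebraMap (MvPolynomial (initSet D) Coeff) (RatField D) (C (X 1)) = beta D := by
  rw [beta, IsScalarTower.algebraMap_apply Coeff (MvPolynomial (initSet D) Coeff) (RatField D)]
  rfl

theorem specializesTo_alpha (α β : F) (x : initSet D → F) :
    SpecializesTo (evalAt α β x) (alpha D) α := by
  simpa [algebraMap_alpha] using
    SpecializesTo.of_algebraMap (K := RatField D) (evalAt α β x) (C (X 0))

theorem specializesTo_beta (α β : F) (x : initSet D → F) :
    SpecializesTo (evalAt α β x) (beta D) β := by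
  simpa [algebraMap_beta] using
    SpecializesTo.of_algebraMap (K := RatField D) (evalAt α β x) (C (X 1))

theorem specializesTo_initVar (α β : F) (x : initSet D → F) (a : initSet D) :
    SpecializesTo (evalAt α β x) (initVar D a) (x a) := by
  simpa [initVar] using
    SpecializesTo.of_algebraMap (K := RatField D) (evalAt α β x) (X a)

theorem specializesTo_exchangeSum {α β : F} {x : initSet D → F} {y : ℤ × ℤ × ℤ → RatField D}
    {z : ℤ × ℤ × ℤ → F} {g : ℤ × ℤ × ℤ}
    (h : ∀ v ∈ neighbors g, SpecializesTo (evalAt α β x) (y v) (z v)) :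
    SpecializesTo (evalAt α β x) (exchangeSum (alpha D) (beta D) y g) (exchangeSum α β z g) := by
  obtain ⟨i, j, k⟩ := g
  have hE := h (i + 1, j, k + 1) (by simp [mem_neighbors_iff])
  have hW := h (i - 1, j, k + 1) (by simp [mem_neighbors_iff])
  have hN := h (i, j + 1, k + 1) (by simp [mem_neighbors_iff])
  have hS := h (i, j - 1, k + 1) (by simp [mem_neighbors_iff])
  exact (((specializesTo_alpha α β x).mul hE).mul hW).add
    (((specializesTo_beta α β x).mul hN).mul hS)

/-- The recurrence is assumed only after a nonzero entry, so that the lemma applies to an array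
computed by division before its entries are known to be nonzero. -/
theorem specializesTo_of_recurrence (hD : IsConvexIndexSet D) {y : ℤ × ℤ × ℤ → RatField D}
    (init : ∀ a : initSet D, y a = initVar D a)
    (recurrence : ∀ i j k : ℤ, (i, j, k) ∈ D → (i, j, k + 2) ∈ D → y (i, j, k) ≠ 0 →
      y (i, j, k + 2) * y (i, j, k) = exchangeSum (alpha D) (beta D) y (i, j, k))
    {α β : F} {z : ℤ × ℤ × ℤ → F} (hz : IsSolution D α β z) :
    ∀ g ∈ D, SpecializesTo (evalAt α β fun a : initSet D => z a) (y g) (z g) := by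
  refine hD.induction (fun g hg => ?_) fun i j k h h2 hk hnbr => ?_
  · rw [init ⟨g, hg⟩]
    exact specializesTo_initVar α β _ ⟨g, hg⟩
  · have hz0 := hz.ne_zero _ h
    have hsum := specializesTo_exchangeSum hnbr
    rw [← recurrence i j k h h2 (hk.ne_zero hz0), ← hz.recurrence i j k h h2] at hsum
    simpa only [mul_div_cancel_right₀ _ hz0] using hsum.of_mul hk hz0

theorem ne_zero_of_recurrence (hD : IsConvexIndexSet D) {y : ℤ × ℤ × ℤ → RatField D}
    (init : ∀ a : initSet D, y a = initVar D a)
    (recurrence : ∀ i j k : ℤ, (i, j, k) ∈ D → (i, j, k + 2) ∈ D → y (i, j, k) ≠ 0 →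
      y (i, j, k + 2) * y (i, j, k) = exchangeSum (alpha D) (beta D) y (i, j, k))
    {g : ℤ × ℤ × ℤ} (hg : g ∈ D) : y g ≠ 0 := by
  have hpos : IsSolution D (1 : ℚ) 1 (recurrenceArray hD 1 1 fun _ => 1) :=
    isSolution_recurrenceArray_of_pos hD one_pos one_pos fun _ => one_pos
  exact (specializesTo_of_recurrence hD init recurrence hpos g hg).ne_zero (hpos.ne_zero g hg)

theorem IsOctahedronArray.isSolution (hD : IsConvexIndexSet D) {y : ℤ × ℤ × ℤ → RatField D}
    (hy : IsOctahedronArray D y) : IsSolution D (alpha D) (beta D) y := by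
  have recurrence : ∀ i j k : ℤ, (i, j, k) ∈ D → (i, j, k + 2) ∈ D →
      y (i, j, k + 2) * y (i, j, k) = exchangeSum (alpha D) (beta D) y (i, j, k) := by
    intro i j k h h2
    have hk : k + 2 - 1 = k + 1 := by ring
    simpa only [exchangeSum, add_sub_cancel_right, hk] using
      hy.recurrence i j (k + 2) h2 (by rwa [add_sub_cancel_right])
  refine ⟨fun g hg => ?_, recurrence⟩
  exact ne_zero_of_recurrence hD hy.init (fun i j k h h2 _ => recurrence i j k h h2) hg

theorem IsOctahedronArray.specializesTo (hD : IsConvexIndexSet D) {y : ℤ × ℤ × ℤ → RatField D}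
    (hy : IsOctahedronArray D y) {α β : F} {z : ℤ × ℤ × ℤ → F} (hz : IsSolution D α β z)
    {g : ℤ × ℤ × ℤ} (hg : g ∈ D) :
    SpecializesTo (evalAt α β fun a : initSet D => z a) (y g) (z g) :=
  specializesTo_of_recurrence hD hy.init
    (fun i j k h h2 _ => (hy.isSolution hD).recurrence i j k h h2) hz g hg

theorem isOctahedronArray_recurrenceArray (hD : IsConvexIndexSet D) :
    IsOctahedronArray D (recurrenceArray hD (alpha D) (beta D) (initVar D)) where
  init := recurrenceArray_init hD _ _ _
  recurrence i j k h h2 := by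
    obtain ⟨k, rfl⟩ : ∃ k', k = k' + 2 := ⟨k - 2, by ring⟩
    have hk : k + 2 - 1 = k + 1 := by ring
    rw [add_sub_cancel_right] at h2 ⊢
    have hne : recurrenceArray hD (alpha D) (beta D) (initVar D) (i, j, k) ≠ 0 :=
      ne_zero_of_recurrence hD (recurrenceArray_init hD _ _ _) (fun i j k h h2 hne => by
        rw [recurrenceArray_step hD _ _ _ h h2, div_mul_cancel₀ _ hne]) h2
    rw [recurrenceArray_step hD _ _ _ h2 h, div_mul_cancel₀ _ hne, exchangeSum, hk]

/-- The monomials in the variables, with coefficient `1`. -/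
noncomputable def monomials (σ : Type*) : Submonoid (MvPolynomial σ Coeff) :=
  Submonoid.closure (Set.range X)

theorem monomials_le_nonZeroDivisors (σ : Type*) :
    monomials σ ≤ nonZeroDivisors (MvPolynomial σ Coeff) := by
  rw [monomials, Submonoid.closure_le]
  rintro _ ⟨a, rfl⟩
  exact mem_nonZeroDivisors_of_ne_zero (X_ne_zero a)

theorem evalAt_ne_zero_of_mem_monomials {σ : Type*} {α β : F} {x : σ → F} (hx : ∀ a, x a ≠ 0)
    {m : MvPolynomial σ Coeff} (hm : m ∈ monomials σ) : evalAt α β x m ≠ 0 := by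
  induction hm using Submonoid.closure_induction with
  | mem m hm =>
    obtain ⟨a, rfl⟩ := hm
    simpa using hx a
  | one => simp
  | mul p q _ _ hp hq =>
    rw [map_mul]
    exact mul_ne_zero hp hq

theorem inv_evalAt_mem_of_mem_monomials {σ : Type*} {S : Subring F} {α β : F} {x : σ → F}
    (hx : ∀ a, (x a)⁻¹ ∈ S) {m : MvPolynomial σ Coeff} (hm : m ∈ monomials σ) :
    (evalAt α β x m)⁻¹ ∈ S := by
  induction hm using Submonoid.closure_induction with
  | mem m hm =>
    obtain ⟨a, rfl⟩ := hm
    simpa using hx a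
  | one => simp
  | mul p q _ _ hp hq =>
    rw [map_mul, mul_inv]
    exact mul_mem hp hq

/-- The Laurent polynomials in the variables attached to the initial indices of `D`, as the
fractions whose denominator is a monomial. -/
noncomputable def laurentFractions (D : Set (ℤ × ℤ × ℤ)) :
    Subalgebra (MvPolynomial (initSet D) Coeff) (RatField D) :=
  Localization.subalgebra.ofField (RatField D) (monomials (initSet D))
    (monomials_le_nonZeroDivisors _)

theorem IsSolution.mem_laurentSubring_of_mem_laurentFractions (hD : IsConvexIndexSet D)
    {y : ℤ × ℤ × ℤ → RatField D} (hy : IsOctahedronArray D y) {g : ℤ × ℤ × ℤ} (hg : g ∈ D)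
    (h : y g ∈ laurentFractions D) {α β : F} {z : ℤ × ℤ × ℤ → F} (hz : IsSolution D α β z) :
    z g ∈ laurentSubring D α β z := by
  obtain ⟨r, m, hm, hyg⟩ := h
  have hm0 : algebraMap _ (RatField D) m ≠ 0 :=
    IsLocalization.to_map_ne_zero_of_mem_nonZeroDivisors _ le_rfl
      (monomials_le_nonZeroDivisors _ hm)
  have hz0 : evalAt α β (fun a : initSet D => z a) m ≠ 0 :=
    evalAt_ne_zero_of_mem_monomials (fun a => hz.ne_zero _ a.2.1) hm
  have hzg := (hy.specializesTo hD hz hg).eq_of_mul_eq ((eq_mul_inv_iff_mul_eq₀ hm0).1 hyg)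
  rw [(eq_mul_inv_iff_mul_eq₀ hz0).2 hzg]
  exact mul_mem
    (evalAt_mem alpha_mem_laurentSubring beta_mem_laurentSubring
      (fun a => mem_laurentSubring_of_mem_initSet a.2) r)
    (inv_evalAt_mem_of_mem_monomials (fun a => inv_mem_laurentSubring_of_mem_initSet a.2) hm)

end Generic

section Poles

open MvPolynomial

variable {D : Set (ℤ × ℤ × ℤ)} {y : ℤ × ℤ × ℤ → RatField D} {v : ℤ × ℤ × ℤ} {a b c : ℤ}

/-- The values of the initial variables used to exclude poles: `-1` at `v` and `1` elsewhere. -/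
def signAt (v g : ℤ × ℤ × ℤ) : ℚ := if g = v then -1 else 1

theorem signAt_ne_zero (v g : ℤ × ℤ × ℤ) : signAt v g ≠ 0 := by
  unfold signAt
  split_ifs <;> norm_num

theorem exchangeSum_signAt_of_mem {g : ℤ × ℤ × ℤ} (hv : v ∈ neighbors g) :
    exchangeSum 1 1 (signAt v) g = 0 := by
  obtain ⟨i, j, k⟩ := g
  obtain rfl | rfl | rfl | rfl := mem_neighbors_iff.1 hv <;>
    simp only [exchangeSum, signAt, Prod.mk.injEq] <;> grind

theorem exchangeSum_signAt_of_notMem {g : ℤ × ℤ × ℤ} (hv : v ∉ neighbors g) :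
    exchangeSum 1 1 (signAt v) g = 2 := by
  obtain ⟨i, j, k⟩ := g
  simp only [mem_neighbors_iff, not_or] at hv
  obtain ⟨hE, hW, hN, hS⟩ := hv
  simp only [exchangeSum, signAt, if_neg (Ne.symm hE), if_neg (Ne.symm hW), if_neg (Ne.symm hN),
    if_neg (Ne.symm hS)]
  norm_num

/-- The evaluation at `α = β = 1` and the values `signAt v` of the initial variables. -/
noncomputable def signEval (D : Set (ℤ × ℤ × ℤ)) (v : ℤ × ℤ × ℤ) :
    MvPolynomial (initSet D) Coeff →+* ℚ :=
  evalAt 1 1 fun g => signAt v g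

theorem specializesTo_signAt (hy : IsOctahedronArray D y) {g : ℤ × ℤ × ℤ} (hg : g ∈ initSet D) :
    SpecializesTo (signEval D v) (y g) (signAt v g) := by
  rw [hy.init ⟨g, hg⟩]
  exact specializesTo_initVar 1 1 _ ⟨g, hg⟩

theorem isUnitAt_of_mem_initSet (hy : IsOctahedronArray D y) {g : ℤ × ℤ × ℤ} (hg : g ∈ initSet D) :
    IsUnitAt (signEval D v) (y g) :=
  ⟨_, signAt_ne_zero v g, specializesTo_signAt hy hg⟩

theorem IsSolution.isUnitAt_step (hy : IsSolution D (alpha D) (beta D) y) {i j k : ℤ}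
    (h : (i, j, k) ∈ D) (h2 : (i, j, k + 2) ∈ D) (hu : IsUnitAt (signEval D v) (y (i, j, k)))
    {z : ℤ × ℤ × ℤ → ℚ} (hz : ∀ u ∈ neighbors (i, j, k), SpecializesTo (signEval D v) (y u) (z u))
    (hne : exchangeSum 1 1 z (i, j, k) ≠ 0) : IsUnitAt (signEval D v) (y (i, j, k + 2)) := by
  obtain ⟨w, hw, hyw⟩ := hu
  have hsum := specializesTo_exchangeSum hz
  rw [← hy.recurrence i j k h h2] at hsum
  exact ⟨_, div_ne_zero hne hw, hsum.of_mul hyw hw⟩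

theorem laurentSubring_le_regularSubring {D' : Set (ℤ × ℤ × ℤ)}
    (h : ∀ g ∈ initSet D', IsUnitAt (signEval D v) (y g)) :
    laurentSubring D' (alpha D) (beta D) y ≤ regularSubring (RatField D) (signEval D v) :=
  laurentSubring_le ⟨1, specializesTo_alpha 1 1 _⟩ ⟨1, specializesTo_beta 1 1 _⟩ fun g hg =>
    ⟨(h g hg).mem_regularSubring, (h g hg).inv.mem_regularSubring⟩

theorem exists_prime_exchange_eq (hD : IsConvexIndexSet D) (hy : IsOctahedronArray D y)
    (ha : IsBottom D (a, b, c)) (hY : (a, b, c + 2) ∈ D) :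
    ∃ P : MvPolynomial (initSet D) Coeff, Prime P ∧
      y (a, b, c + 2) * y (a, b, c) = algebraMap _ (RatField D) P ∧
      ∀ v ∈ neighbors (a, b, c), signEval D v P = 0 := by
  have hnbr : ∀ v ∈ neighbors (a, b, c), v ∈ initSet D := ha.neighbors_subset_initSet hD hY
  have hE := hnbr (a + 1, b, c + 1) (by simp [mem_neighbors_iff])
  have hW := hnbr (a - 1, b, c + 1) (by simp [mem_neighbors_iff])
  have hN := hnbr (a, b + 1, c + 1) (by simp [mem_neighbors_iff])
  have hS := hnbr (a, b - 1, c + 1) (by simp [mem_neighbors_iff])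
  refine ⟨exchangePoly ⟨_, hE⟩ ⟨_, hW⟩ ⟨_, hN⟩ ⟨_, hS⟩, prime_exchangePoly ?_ ?_ ?_ ?_ ?_, ?_, ?_⟩
  · simp only [ne_eq, Subtype.mk.injEq, Prod.mk.injEq]
    omega
  · simp
  · simp
  · simp
  · simp
  · rw [(hy.isSolution hD).recurrence a b c ha.1 hY, exchangeSum, hy.init ⟨_, hE⟩,
      hy.init ⟨_, hW⟩, hy.init ⟨_, hN⟩, hy.init ⟨_, hS⟩]
    simp only [exchangePoly, initVar, map_add, map_mul, algebraMap_alpha, algebraMap_beta]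
  · intro v hv
    rw [signEval, evalAt_exchangePoly]
    exact exchangeSum_signAt_of_mem hv

theorem mem_laurentFractions_of_mem_initSet (hy : IsOctahedronArray D y) {g : ℤ × ℤ × ℤ}
    (hg : g ∈ initSet D) : y g ∈ laurentFractions D ∧ (y g)⁻¹ ∈ laurentFractions D := by
  rw [hy.init ⟨g, hg⟩]
  exact ⟨algebraMap_mem _ _,
    inv_algebraMap_mem_ofField (Submonoid.subset_closure ⟨_, rfl⟩)⟩

theorem laurentSubring_le_laurentFractions (hy : IsOctahedronArray D y) :
    laurentSubring D (alpha D) (beta D) y ≤ (laurentFractions D).toSubring := by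
  refine laurentSubring_le ?_ ?_ fun g hg => mem_laurentFractions_of_mem_initSet hy hg
  · exact algebraMap_alpha D ▸ algebraMap_mem (laurentFractions D) _
  · exact algebraMap_beta D ▸ algebraMap_mem (laurentFractions D) _

theorem ofField_mono {R K : Type*} [CommRing R] [Field K] [Algebra R K] [IsFractionRing R K]
    {M N : Submonoid R} {hM : M ≤ nonZeroDivisors R} {hN : N ≤ nonZeroDivisors R} (h : M ≤ N) :
    Localization.subalgebra.ofField K M hM ≤ Localization.subalgebra.ofField K N hN :=
  fun _ ⟨r, s, hs, hu⟩ => ⟨r, s, h hs, hu⟩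

/-- Removing the bottom point `(a, b, c)` from `D` replaces the initial entry `x` there by `P / x`,
so that only `P` occurs as a new denominator. -/
theorem laurentSubring_sdiff_isBottom_le (hy : IsOctahedronArray D y) (ha : IsBottom D (a, b, c))
    (hne : y (a, b, c) ≠ 0) {P : MvPolynomial (initSet D) Coeff}
    (hP : y (a, b, c + 2) * y (a, b, c) = algebraMap _ (RatField D) P)
    (hden : monomials (initSet D) ⊔ Submonoid.powers P ≤ nonZeroDivisors _) :
    laurentSubring (D \ lowerCone (a, b, c)) (alpha D) (beta D) y ≤
      (Localization.subalgebra.ofField (RatField D) _ hden).toSubring := by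
  have hle : (laurentFractions D).toSubring ≤
      (Localization.subalgebra.ofField (RatField D) _ hden).toSubring :=
    ofField_mono (hM := monomials_le_nonZeroDivisors _) (hN := hden) le_sup_left
  have hinit : laurentSubring D (alpha D) (beta D) y ≤ _ :=
    (laurentSubring_le_laurentFractions hy).trans hle
  refine laurentSubring_le (hinit alpha_mem_laurentSubring) (hinit beta_mem_laurentSubring)
    fun g hg => ?_
  obtain hg | ⟨rfl, -⟩ := ha.mem_initSet_sdiff_lowerCone hg
  · exact ⟨hinit (mem_laurentSubring_of_mem_initSet hg),
      hinit (inv_mem_laurentSubring_of_mem_initSet hg)⟩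
  · rw [(eq_mul_inv_iff_mul_eq₀ hne).2 hP, mul_inv, inv_inv]
    exact ⟨mul_mem (algebraMap_mem (Localization.subalgebra.ofField (RatField D) _ hden) P)
        (hinit (inv_mem_laurentSubring_of_mem_initSet ha.mem_initSet)),
      mul_mem (inv_algebraMap_mem_ofField (hT := hden)
          (Submonoid.mem_sup_right (Submonoid.mem_powers P)))
        (hinit (mem_laurentSubring_of_mem_initSet ha.mem_initSet))⟩

theorem isUnitAt_of_mem_initSet_sdiff_isBottom (hD : IsConvexIndexSet D)
    (hy : IsOctahedronArray D y) (ha : IsBottom D (a, b, c)) (hv : v ∉ neighbors (a, b, c))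
    {g : ℤ × ℤ × ℤ} (hg : g ∈ initSet (D \ lowerCone (a, b, c))) :
    IsUnitAt (signEval D v) (y g) := by
  obtain hg | ⟨rfl, hY⟩ := ha.mem_initSet_sdiff_lowerCone hg
  · exact isUnitAt_of_mem_initSet hy hg
  · refine (hy.isSolution hD).isUnitAt_step ha.1 hY (isUnitAt_of_mem_initSet hy ha.mem_initSet)
      (fun u hu => specializesTo_signAt hy (ha.neighbors_subset_initSet hD hY hu)) ?_
    rw [exchangeSum_signAt_of_notMem hv]
    exact two_ne_zero

end Poles

section Confinement

variable {D : Set (ℤ × ℤ × ℤ)} {y : ℤ × ℤ × ℤ → RatField D} {v : ℤ × ℤ × ℤ} {a b c : ℤ}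

/-- The numerator of the entry at `(a, b, c + 4)` over the product of its four predecessors on
level `c + 1`, as a polynomial in the entries up to level `c + 2`. It arises by substituting the
recurrence on level `c + 3` into the one for `(a, b, c + 4)` and cancelling the entry at
`(a, b, c + 2)`. -/
def confinementSum {K : Type*} [Field K] (α β : K) (y : ℤ × ℤ × ℤ → K) : ℤ × ℤ × ℤ → K
  | (a, b, c) =>
    α * (y (a, b + 1, c + 1) * y (a, b - 1, c + 1)) *
      (α * α * y (a, b, c + 2) * y (a + 2, b, c + 2) * y (a - 2, b, c + 2) +
        α * β * (y (a + 2, b, c + 2) * (y (a - 1, b + 1, c + 2) * y (a - 1, b - 1, c + 2)) +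
          y (a - 2, b, c + 2) * (y (a + 1, b + 1, c + 2) * y (a + 1, b - 1, c + 2)))) +
    β * (y (a + 1, b, c + 1) * y (a - 1, b, c + 1)) *
      (β * β * y (a, b, c + 2) * y (a, b + 2, c + 2) * y (a, b - 2, c + 2) +
        α * β * (y (a, b + 2, c + 2) * (y (a + 1, b - 1, c + 2) * y (a - 1, b - 1, c + 2)) +
          y (a, b - 2, c + 2) * (y (a + 1, b + 1, c + 2) * y (a - 1, b + 1, c + 2)))) +
    α * β * (y (a + 1, b + 1, c + 2) * y (a + 1, b - 1, c + 2)) *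
      (y (a - 1, b + 1, c + 2) * y (a - 1, b - 1, c + 2)) * y (a, b, c)

theorem IsSolution.mul_eq_confinementSum (hD : IsConvexIndexSet D) {K : Type*} [Field K] {α β : K}
    {y : ℤ × ℤ × ℤ → K} (hy : IsSolution D α β y) (ha : (a, b, c) ∈ D) (hY : (a, b, c + 2) ∈ D)
    (hZ : (a, b, c + 4) ∈ D) :
    y (a, b, c + 4) * (y (a + 1, b, c + 1) * y (a - 1, b, c + 1) *
      (y (a, b + 1, c + 1) * y (a, b - 1, c + 1))) = confinementSum α β y (a, b, c) := by
  have hc : c + 2 + 2 = c + 4 := by ring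
  have hc' : c + 1 + 2 = c + 3 := by ring
  have step : ∀ i j : ℤ, (i, j, c + 1) ∈ neighbors (a, b, c) →
      (i, j, c + 3) ∈ neighbors (a, b, c + 2) →
      y (i, j, c + 3) * y (i, j, c + 1) = exchangeSum α β y (i, j, c + 1) := by
    intro i j h h2
    rw [← hy.recurrence i j (c + 1) (hD.neighbors_subset ha hY h)
      (hc' ▸ hD.neighbors_subset hY (hc ▸ hZ) h2), hc']
  have hYa := hy.recurrence a b c ha hY
  have hZY := hy.recurrence a b (c + 2) hY (hc ▸ hZ)
  have hE := step (a + 1) b (by simp [mem_neighbors_iff]) (by grind [mem_neighbors_iff])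
  have hW := step (a - 1) b (by simp [mem_neighbors_iff]) (by grind [mem_neighbors_iff])
  have hN := step a (b + 1) (by simp [mem_neighbors_iff]) (by grind [mem_neighbors_iff])
  have hS := step a (b - 1) (by simp [mem_neighbors_iff]) (by grind [mem_neighbors_iff])
  simp only [exchangeSum, add_assoc, sub_sub, add_sub_cancel_right, sub_add_cancel,
    Int.reduceAdd] at hYa hZY hE hW hN hS
  apply mul_right_cancel₀ (hy.ne_zero _ hY)
  rw [confinementSum]
  linear_combination
    y (a + 1, b, c + 1) * y (a - 1, b, c + 1) * (y (a, b + 1, c + 1) * y (a, b - 1, c + 1)) * hZY +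
    α * (y (a, b + 1, c + 1) * y (a, b - 1, c + 1)) *
      (y (a - 1, b, c + 3) * y (a - 1, b, c + 1)) * hE +
    α * (y (a, b + 1, c + 1) * y (a, b - 1, c + 1)) *
      (α * y (a + 2, b, c + 2) * y (a, b, c + 2) +
        β * y (a + 1, b + 1, c + 2) * y (a + 1, b - 1, c + 2)) * hW +
    β * (y (a + 1, b, c + 1) * y (a - 1, b, c + 1)) *
      (y (a, b - 1, c + 3) * y (a, b - 1, c + 1)) * hN +
    β * (y (a + 1, b, c + 1) * y (a - 1, b, c + 1)) *
      (α * y (a + 1, b + 1, c + 2) * y (a - 1, b + 1, c + 2) +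
        β * y (a, b + 2, c + 2) * y (a, b, c + 2)) * hS -
    α * β * (y (a + 1, b + 1, c + 2) * y (a + 1, b - 1, c + 2)) *
      (y (a - 1, b + 1, c + 2) * y (a - 1, b - 1, c + 2)) * hYa

theorem specializesTo_confinementSum (hD : IsConvexIndexSet D) {F : Type*} [Field F] {α β : F}
    {x : initSet D → F} {z : ℤ × ℤ × ℤ → F} (ha : (a, b, c) ∈ D)
    (hZ : (a, b, c + 4) ∈ D)
    (h : ∀ g ∈ D, g.2.2 ≤ c + 2 → SpecializesTo (evalAt α β x) (y g) (z g)) :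
    SpecializesTo (evalAt α β x) (confinementSum (alpha D) (beta D) y (a, b, c))
      (confinementSum α β z (a, b, c)) := by
  have he := mem_evenLattice.1 (hD.subset_lattice ha)
  have between : ∀ i j k : ℤ, (i + j + k) % 2 = 0 ∧ k ≤ c + 2 ∧ InCone (a, b, c) (i, j, k) ∧
      InCone (i, j, k) (a, b, c + 4) → SpecializesTo (evalAt α β x) (y (i, j, k)) (z (i, j, k)) :=
    fun i j k ⟨hijk, hk, h1, h2⟩ =>
      h _ (hD.between_mem _ ha _ hZ _ (mem_evenLattice.2 hijk) h1 h2) hk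
  simp only [inCone_iff] at between
  have h0 := between a b c (by omega)
  have hE := between (a + 1) b (c + 1) (by omega)
  have hW := between (a - 1) b (c + 1) (by omega)
  have hN := between a (b + 1) (c + 1) (by omega)
  have hS := between a (b - 1) (c + 1) (by omega)
  have hY := between a b (c + 2) (by omega)
  have hEE := between (a + 2) b (c + 2) (by omega)
  have hWW := between (a - 2) b (c + 2) (by omega)
  have hNN := between a (b + 2) (c + 2) (by omega)
  have hSS := between a (b - 2) (c + 2) (by omega)
  have hNE := between (a + 1) (b + 1) (c + 2) (by omega)
  have hNW := between (a - 1) (b + 1) (c + 2) (by omega)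
  have hSE := between (a + 1) (b - 1) (c + 2) (by omega)
  have hSW := between (a - 1) (b - 1) (c + 2) (by omega)
  have hα := specializesTo_alpha α β x
  have hβ := specializesTo_beta α β x
  have hNS := (hα.mul (hN.mul hS)).mul (((((hα.mul hα).mul hY).mul hEE).mul hWW).add
    ((hα.mul hβ).mul ((hEE.mul (hNW.mul hSW)).add (hWW.mul (hNE.mul hSE)))))
  have hEW := (hβ.mul (hE.mul hW)).mul (((((hβ.mul hβ).mul hY).mul hNN).mul hSS).add
    ((hα.mul hβ).mul ((hNN.mul (hSE.mul hSW)).add (hSS.mul (hNE.mul hNW)))))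
  exact (hNS.add hEW).add ((((hα.mul hβ).mul (hNE.mul hSE)).mul (hNW.mul hSW)).mul h0)

theorem specializesTo_of_height_le (hD : IsConvexIndexSet D) (hy : IsOctahedronArray D y)
    (ha : IsBottom D (a, b, c)) (hle : ∀ g ∈ D, InCone (a, b, c) g) (hY : (a, b, c + 2) ∈ D)
    (hv : v ∈ neighbors (a, b, c)) {g : ℤ × ℤ × ℤ} (hg : g ∈ D) (hgc : g.2.2 ≤ c + 2) :
    SpecializesTo (signEval D v) (y g) (Function.update (signAt v) (a, b, c + 2) 0 g) := by
  by_cases hgY : g = (a, b, c + 2)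
  · subst hgY
    have hsum := specializesTo_exchangeSum fun u hu =>
      specializesTo_signAt (v := v) hy (ha.neighbors_subset_initSet hD hY hu)
    rw [exchangeSum_signAt_of_mem hv, ← (hy.isSolution hD).recurrence a b c ha.1 hY] at hsum
    rw [Function.update_self, ← zero_div (signAt v (a, b, c))]
    exact hsum.of_mul (specializesTo_signAt hy ha.mem_initSet) (signAt_ne_zero v _)
  · rw [Function.update_of_ne hgY]
    refine specializesTo_signAt hy ⟨hg, fun h => hgY ?_⟩
    obtain ⟨i, j, k⟩ := g
    have hcone := inCone_iff.1 (hle (i, j, k - 2) h)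
    simp only [Prod.mk.injEq] at hgc ⊢
    omega

theorem exchangeSum_update_signAt {i j k : ℤ} (hv : v ∈ neighbors (a, b, c))
    (hu : (i, j, k) ∈ neighbors (a, b, c)) :
    exchangeSum 1 1 (Function.update (signAt v) (a, b, c + 2) 0) (i, j, k) = 1 := by
  have hc : c + 1 + 1 = c + 2 := by ring
  simp only [mem_neighbors_iff, Prod.mk.injEq] at hu
  obtain rfl | rfl | rfl | rfl := mem_neighbors_iff.1 hv <;>
    obtain ⟨rfl, rfl, rfl⟩ | ⟨rfl, rfl, rfl⟩ | ⟨rfl, rfl, rfl⟩ | ⟨rfl, rfl, rfl⟩ := hu <;>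
    simp [exchangeSum, signAt, Function.update_apply, hc]

theorem isUnitAt_above_neighbor (hD : IsConvexIndexSet D) (hy : IsOctahedronArray D y)
    (ha : IsBottom D (a, b, c)) (hle : ∀ g ∈ D, InCone (a, b, c) g) (hY : (a, b, c + 2) ∈ D)
    (hv : v ∈ neighbors (a, b, c)) {i j k : ℤ} (hu : (i, j, k) ∈ neighbors (a, b, c))
    (h : (i, j, k + 2) ∈ D) : IsUnitAt (signEval D v) (y (i, j, k + 2)) := by
  have huD := ha.neighbors_subset_initSet hD hY hu
  refine (hy.isSolution hD).isUnitAt_step huD.1 h (isUnitAt_of_mem_initSet hy huD)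
    (fun w hw => specializesTo_of_height_le hD hy ha hle hY hv
      (hD.neighbors_subset huD.1 h hw) ?_) ?_
  · rcases hu with hu | hu | hu | hu <;> rcases hw with rfl | rfl | rfl | rfl <;> grind
  · rw [exchangeSum_update_signAt hv hu]
    exact one_ne_zero

/-- Although the entry at `(a, b, c + 2)` vanishes, the confinement identity gives the entry at
`(a, b, c + 4)` a nonzero value. -/
theorem isUnitAt_above_confined (hD : IsConvexIndexSet D) (hy : IsOctahedronArray D y)
    (ha : IsBottom D (a, b, c)) (hle : ∀ g ∈ D, InCone (a, b, c) g) (hY : (a, b, c + 2) ∈ D)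
    (hv : v ∈ neighbors (a, b, c)) (hZ : (a, b, c + 4) ∈ D) :
    IsUnitAt (signEval D v) (y (a, b, c + 4)) := by
  have hval : confinementSum 1 1 (Function.update (signAt v) (a, b, c + 2) 0) (a, b, c) = 1 := by
    have hne : ∀ n : ℤ, n + 1 ≠ n - 1 := fun n => by omega
    obtain rfl | rfl | rfl | rfl := mem_neighbors_iff.1 hv <;>
      simp [confinementSum, signAt, hne, (hne _).symm]
  have hsum := specializesTo_confinementSum hD ha.1 hZ fun g hg hgc =>
    specializesTo_of_height_le hD hy ha hle hY hv hg hgc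
  rw [hval, ← (hy.isSolution hD).mul_eq_confinementSum hD ha.1 hY hZ] at hsum
  have hinit : ∀ u ∈ neighbors (a, b, c), SpecializesTo (signEval D v) (y u) (signAt v u) :=
    fun u hu => specializesTo_signAt hy (ha.neighbors_subset_initSet hD hY hu)
  have hE := hinit (a + 1, b, c + 1) (by simp [mem_neighbors_iff])
  have hW := hinit (a - 1, b, c + 1) (by simp [mem_neighbors_iff])
  have hN := hinit (a, b + 1, c + 1) (by simp [mem_neighbors_iff])
  have hS := hinit (a, b - 1, c + 1) (by simp [mem_neighbors_iff])
  have hne : signAt v (a + 1, b, c + 1) * signAt v (a - 1, b, c + 1) *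
      (signAt v (a, b + 1, c + 1) * signAt v (a, b - 1, c + 1)) ≠ 0 := by
    simp only [ne_eq, mul_eq_zero, signAt_ne_zero, or_self, not_false_eq_true]
  exact ⟨_, div_ne_zero one_ne_zero hne, hsum.of_mul ((hE.mul hW).mul (hN.mul hS)) hne⟩

theorem isUnitAt_of_mem_initSet_sdiff_lowerCone (hD : IsConvexIndexSet D)
    (hy : IsOctahedronArray D y) (ha : IsBottom D (a, b, c)) (hle : ∀ g ∈ D, InCone (a, b, c) g)
    (hY : (a, b, c + 2) ∈ D) (hv : v ∈ neighbors (a, b, c)) {g : ℤ × ℤ × ℤ}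
    (hg : g ∈ initSet (D \ lowerCone (a, b, c + 2))) : IsUnitAt (signEval D v) (y g) := by
  obtain hg | ⟨i, j, k, rfl, hgD, hgY, hk, hkY⟩ := mem_initSet_sdiff_lowerCone hg
  · exact isUnitAt_of_mem_initSet hy hg
  obtain hka | hku | hkY := eq_or_mem_neighbors_or_eq (hD.subset_lattice ha.1)
    (hD.subset_lattice hk) (hle _ hk) hkY
  · obtain ⟨rfl, rfl, rfl⟩ : i = a ∧ j = b ∧ k = c := by simpa using hka
    exact absurd (InCone.refl _) hgY
  · exact isUnitAt_above_neighbor hD hy ha hle hY hv hku hgD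
  · obtain ⟨rfl, rfl, rfl⟩ : i = a ∧ j = b ∧ k = c + 2 := by simpa using hkY
    have hc : c + 2 + 2 = c + 4 := by ring
    rw [hc] at hgD ⊢
    exact isUnitAt_above_confined hD hy ha hle hY hv hgD

end Confinement

section Laurent

variable {D : Set (ℤ × ℤ × ℤ)} {y : ℤ × ℤ × ℤ → RatField D} {a b c : ℤ} {t : ℤ × ℤ × ℤ}

theorem exists_mem_regularSubring (hD : IsConvexIndexSet D) (hy : IsOctahedronArray D y)
    (ha : IsBottom D (a, b, c)) (hY : (a, b, c + 2) ∈ D) (ht : t ∈ D)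
    (ih : ∀ p ∈ D, ¬ InCone t p → y t ∈ laurentSubring (D \ lowerCone p) (alpha D) (beta D) y)
    (hinit : t ∉ initSet D) :
    ∃ v ∈ neighbors (a, b, c), y t ∈ regularSubring (RatField D) (signEval D v) := by
  by_cases hle : ∀ g ∈ D, InCone (a, b, c) g
  · have hv : (a + 1, b, c + 1) ∈ neighbors (a, b, c) := by simp [mem_neighbors_iff]
    refine ⟨_, hv, ?_⟩
    by_cases htY : InCone t (a, b, c + 2)
    · refine ⟨_, specializesTo_of_height_le hD hy ha hle hY hv ht ?_⟩
      simp only [InCone] at htY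
      grind
    · exact laurentSubring_le_regularSubring
        (fun g => isUnitAt_of_mem_initSet_sdiff_lowerCone hD hy ha hle hY hv) (ih _ hY htY)
  · push Not at hle
    obtain ⟨g, hg, hag⟩ := hle
    obtain ⟨a', ha', ha'g⟩ := hD.exists_isBottom_inCone hg
    obtain ⟨v, hv, hv'⟩ : ∃ v ∈ neighbors (a, b, c), v ∉ neighbors a' :=
      exists_mem_neighbors_notMem fun h => hag (h ▸ ha'g)
    have hta' : ¬ InCone t a' := fun h => hinit (ha'.2 t ht h ▸ ha'.mem_initSet)
    exact ⟨v, hv, laurentSubring_le_regularSubring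
      (fun g => isUnitAt_of_mem_initSet_sdiff_isBottom hD hy ha' hv') (ih _ ha'.1 hta')⟩

theorem mem_laurentFractions (hD : IsConvexIndexSet D) (hy : IsOctahedronArray D y) (ht : t ∈ D)
    (ih : ∀ p ∈ D, ¬ InCone t p → y t ∈ laurentSubring (D \ lowerCone p) (alpha D) (beta D) y) :
    y t ∈ laurentFractions D := by
  by_cases hinit : t ∈ initSet D
  · exact (mem_laurentFractions_of_mem_initSet hy hinit).1
  obtain ⟨⟨a, b, c⟩, ha, -⟩ := hD.exists_isBottom_inCone ht
  have hta : ¬ InCone t (a, b, c) := fun h => hinit (ha.2 t ht h ▸ ha.mem_initSet)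
  by_cases hY : (a, b, c + 2) ∈ D
  · obtain ⟨P, hP, hyP, hzero⟩ := exists_prime_exchange_eq hD hy ha hY
    have hden : monomials (initSet D) ⊔ Submonoid.powers P ≤ nonZeroDivisors _ :=
      sup_le (monomials_le_nonZeroDivisors _)
        (Submonoid.powers_le.2 (mem_nonZeroDivisors_of_ne_zero hP.ne_zero))
    obtain ⟨v, hv, hreg⟩ := exists_mem_regularSubring hD hy ha hY ht ih hinit
    refine mem_ofField_of_mem_sup_powers (hMP := hden) hP (hzero v hv) ?_ hreg
    exact laurentSubring_sdiff_isBottom_le hy ha ((hy.isSolution hD).ne_zero _ ha.1) hyP hden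
      (ih _ ha.1 hta)
  · have hsub : initSet (D \ lowerCone (a, b, c)) ⊆ initSet D := fun g hg =>
      (ha.mem_initSet_sdiff_lowerCone hg).resolve_right fun h => hY h.2
    exact laurentSubring_le_laurentFractions hy (laurentSubring_mono hsub (ih _ ha.1 hta))

theorem recurrenceArray_mem_laurentFractions (hD : IsConvexIndexSet D) (hfin : D.Finite)
    (ht : t ∈ D) : recurrenceArray hD (alpha D) (beta D) (initVar D) t ∈ laurentFractions D := by
  induction hn : D.ncard using Nat.strong_induction_on generalizing D with
  | _ n ih =>
    subst hn
    have hy := isOctahedronArray_recurrenceArray hD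
    refine mem_laurentFractions hD hy ht fun p hp htp => ?_
    have hD' := hD.sdiff_lowerCone p
    have hlt : (D \ lowerCone p).ncard < D.ncard :=
      Set.ncard_lt_ncard ⟨Set.sdiff_subset, fun h => (h hp).2 (InCone.refl p)⟩ hfin
    exact IsSolution.mem_laurentSubring_of_mem_laurentFractions hD'
      (isOctahedronArray_recurrenceArray hD') ⟨ht, htp⟩
      (ih _ hlt hD' (hfin.subset Set.sdiff_subset) ⟨ht, htp⟩ rfl)
      ((hy.isSolution hD).mono Set.sdiff_subset)

theorem IsSolution.mem_laurentSubring (hD : IsConvexIndexSet D) {F : Type*} [Field F] {α β : F}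
    {z : ℤ × ℤ × ℤ → F} (hz : IsSolution D α β z) (ht : t ∈ D) : z t ∈ laurentSubring D α β z := by
  have hD' := hD.inter_lowerCone t
  have ht' : t ∈ D ∩ lowerCone t := ⟨ht, InCone.refl t⟩
  exact laurentSubring_mono (initSet_inter_lowerCone_subset t)
    (IsSolution.mem_laurentSubring_of_mem_laurentFractions hD'
      (isOctahedronArray_recurrenceArray hD') ht'
      (recurrenceArray_mem_laurentFractions hD' (hD.finite_below t ht) ht')
      (hz.mono Set.inter_subset_left))

theorem IsOctahedronArray.laurentSubring_le_laurentRing (hy : IsOctahedronArray D y) :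
    laurentSubring D (alpha D) (beta D) y ≤ (laurentRing D).toSubring := by
  refine laurentSubring_le ((laurentRing D).algebraMap_mem _) ((laurentRing D).algebraMap_mem _)
    fun g hg => ?_
  rw [hy.init ⟨g, hg⟩]
  exact ⟨Algebra.subset_adjoin (Or.inl ⟨_, rfl⟩), Algebra.subset_adjoin (Or.inr ⟨_, rfl⟩)⟩

end Laurent

end Octahedron

theorem theorem1p3_general (H : Set (ℤ × ℤ × ℤ)) (hH : Octahedron.IsConvexIndexSet H) :
    (∃ y : ℤ × ℤ × ℤ → Octahedron.RatField H, Octahedron.IsOctahedronArray H y) ∧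
    ∀ y : ℤ × ℤ × ℤ → Octahedron.RatField H, Octahedron.IsOctahedronArray H y →
      ∀ h ∈ H, y h ≠ 0 ∧ y h ∈ Octahedron.laurentRing H := by
  refine ⟨⟨_, Octahedron.isOctahedronArray_recurrenceArray hH⟩, fun y hy h hh => ?_⟩
  have hsol := hy.isSolution hH
  exact ⟨hsol.ne_zero h hh, hy.laurentSubring_le_laurentRing (hsol.mem_laurentSubring hH hh)⟩

theorem theorem1p3 (H : Set (ℤ × ℤ × ℤ)) (hH : Octahedron.IsIndexSet H) :
    (∃ y : ℤ × ℤ × ℤ → Octahedron.RatField H, Octahedron.IsOctahedronArray H y) ∧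
    ∀ y : ℤ × ℤ × ℤ → Octahedron.RatField H, Octahedron.IsOctahedronArray H y →
      ∀ h ∈ H, y h ≠ 0 ∧ y h ∈ Octahedron.laurentRing H :=
  theorem1p3_general H hH.isConvexIndexSet
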